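/- Let $\gamma_d$ denote the standard Gaussian measure on $\mathbb{R}^d$. For a Borel set $H\subseteq\mathbb{R}^d$ let $$\Gamma(H)=\liminf_{\delta\to 0^+}\frac{\gamma_d(H_\delta\setminus H)}{\delta}\in[0,\infty]$$ be its Gaussian surface area, where $H_\delta$ is the set of points at Euclidean distance less than $\delta$ from some point of $H$. For $\rho\in[0,1]$ let $T_\rho f(x)=\mathbb{E}_{z\sim\gamma_d}\,f(\rho x+\sqrt{1-\rho^2}\,z)$ be the Ornstein–Uhlenbeck operator, and for an integer $t\ge 0$ let $\Pi_{\le t}$ be the truncation of the Hermite expansion in $L^2(\gamma_d)$ to total degree at most $t$. There is a universal constant $C>0$ such that the following holds for every $d$. Let $\mathcal{H}$ be a class of Borel subsets of $\mathbb{R}^d$ with $\Gamma_{\mathcal H}:=\sup_{H\in\mathcal H}\Gamma(H)<\infty$. Then for every $H\in\mathcal H$ and every $\varepsilon\in(0,1/2)$ there is a polynomial $q_H:\mathbb{R}^d\to[0,\infty)$ with $$\mathbb{E}_{x\sim\gamma_d}\big|q_H(x)-\mathbf 1_H(x)\big|\le\varepsilon\qquad\text{and}\qquad \deg q_H\le C\,\frac{\Gamma_{\mathcal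 H}^2}{\varepsilon^2}\log\frac1\varepsilon .$$ Moreover, $q_H$ can be taken of the form $q_H=\tfrac14(1+p)^2$ with $p=\Pi_{\le t}\,T_\rho(2\cdot\mathbf 1_H-1)$ for some $\rho\in[0,1]$ and some integer $t\ge0$ such that $2t\le C\,\frac{\Gamma_{\mathcal H}^2}{\varepsilon^2}\log\frac1\varepsilon$ and $\mathbb{E}_{x\sim\gamma_d}|p(x)-(2\cdot\mathbf 1_H(x)-1)|\le\varepsilon$; thus $\deg p\le t$ and $\deg q_H\le 2t$, i.e. non-negativity costs at most a factor $2$ over the degree bound $t$ for the unconstrained approximation $p$. -/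

import Mathlib

open MeasureTheory ProbabilityTheory Filter Topology

noncomputable section

namespace GSAApprox

/-- Gaussian surface area of `H ⊆ ℝ^d`: the lower limit of `γ_d (H_δ \ H) / δ` as `δ → 0⁺`,
where `H_δ` is the Euclidean `δ`-neighbourhood of `H`. -/
def gaussianSurfaceArea {d : ℕ} (H : Set (EuclideanSpace ℝ (Fin d))) : ENNReal :=
  liminf (fun δ : ℝ =>
    stdGaussian (EuclideanSpace ℝ (Fin d)) (Metric.thickening δ H \ H) / ENNReal.ofReal δ)
    (𝓝[>] 0)

/-- The supremum of the Gaussian surface areas of the members of a class of sets. -/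
def classSurfaceArea {d : ℕ} (𝓗 : Set (Set (EuclideanSpace ℝ (Fin d)))) : ENNReal :=
  ⨆ H ∈ 𝓗, gaussianSurfaceArea H

/-- The `±1`-valued function `2 · 1_H - 1`. -/
def signFn {d : ℕ} (H : Set (EuclideanSpace ℝ (Fin d))) (x : EuclideanSpace ℝ (Fin d)) : ℝ :=
  2 * H.indicator (fun _ => (1 : ℝ)) x - 1

/-- The Ornstein–Uhlenbeck operator `T_ρ`. -/
def ornsteinUhlenbeck {d : ℕ} (ρ : ℝ) (f : EuclideanSpace ℝ (Fin d) → ℝ)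
    (x : EuclideanSpace ℝ (Fin d)) : ℝ :=
  ∫ z, f (ρ • x + √(1 - ρ ^ 2) • z) ∂(stdGaussian (EuclideanSpace ℝ (Fin d)))

/-- The value of a polynomial in `d` variables at a point of `ℝ^d`. -/
def evalAt {d : ℕ} (p : MvPolynomial (Fin d) ℝ) (x : EuclideanSpace ℝ (Fin d)) : ℝ :=
  MvPolynomial.eval (fun i => x i) p

/-- The multivariate (probabilists') Hermite polynomial `∏ i, He_{α i}(x_i)`. -/
def hermiteMv {d : ℕ} (α : Fin d → ℕ) : MvPolynomial (Fin d) ℝ :=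
  ∏ i, Polynomial.aeval (MvPolynomial.X i) (Polynomial.hermite (α i))

/-- The coefficient of `hermiteMv α` in the Hermite expansion of `g`; recall that
`hermiteMv α` has squared norm `∏ i, (α i)!` in `L²(γ_d)`. -/
def hermiteCoeff {d : ℕ} (g : EuclideanSpace ℝ (Fin d) → ℝ) (α : Fin d → ℕ) : ℝ :=
  (∫ x, g x * evalAt (hermiteMv α) x ∂(stdGaussian (EuclideanSpace ℝ (Fin d)))) /
    ∏ i, ((α i).factorial : ℝ)

/-- Truncation `Π_{≤ t} g` of the Hermite expansion of `g` to total degree at most `t`. -/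
def hermiteTrunc {d : ℕ} (t : ℕ) (g : EuclideanSpace ℝ (Fin d) → ℝ) :
    MvPolynomial (Fin d) ℝ :=
  ∑ k ∈ Finset.range (t + 1), ∑ α ∈ Finset.piAntidiag (Finset.univ : Finset (Fin d)) k,
    MvPolynomial.C (hermiteCoeff g α) * hermiteMv α

end GSAApprox

end

/-!
Write `f = 2 · 1_H - 1`. The smoothing error `‖T_ρ f - f‖₁` is bounded by the average variation of
`f` under the rotation of `γ_d ⊗ γ_d` by the angle `arccos ρ`. That variation is subadditive in the
angle, so it suffices to control it for small angles; there, a rotation moves a Lipschitz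
approximation of `1_H` along a Gaussian gradient direction, which bounds it by the angle times the
surface area. Since `T_ρ` multiplies a degree-`k` Hermite coefficient by `ρ ^ k`, truncating at
degree `t` costs at most `ρ ^ (t + 1)` in `L²`. Balancing the two errors gives `t`. Finally,
`p = Π_{≤ t} T_ρ f` has the mean of `T_ρ f` and `L²`-norm at most one, and this makes the `L¹` error
of `(1 + p)² / 4` as an approximation of `1_H` no larger than that of `p` as one of `f`.
-/

namespace GSAApprox

section HermiteReal

open Polynomial

theorem integrable_eval_gaussianReal (Q : ℝ[X]) :
    Integrable (fun x => Q.eval x) (gaussianReal 0 1) := by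
  induction Q using Polynomial.induction_on' with
  | add p q hp hq => simpa only [eval_add] using hp.fun_add hq
  | monomial n a =>
    simp only [eval_monomial]
    have h := (memLp_id_gaussianReal' (μ := 0) (v := 1) n (by simp)).integrable_norm_pow'
    exact (h.mono' (by fun_prop) (ae_of_all _ fun x => by simp)).const_mul a

theorem integrable_eval_mul_gaussianPDFReal (Q : ℝ[X]) :
    Integrable (fun x => Q.eval x * gaussianPDFReal 0 1 x) := by
  have h := integrable_eval_gaussianReal Q
  rw [gaussianReal_of_var_ne_zero _ one_ne_zero,
    integrable_withDensity_iff_integrable_smul' (by fun_prop)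
      (ae_of_all _ fun x => gaussianPDF_lt_top)] at h
  simpa only [toReal_gaussianPDF, smul_eq_mul, mul_comm] using h

theorem hasDerivAt_gaussianPDFReal (x : ℝ) :
    HasDerivAt (gaussianPDFReal 0 1) (-(x * gaussianPDFReal 0 1 x)) x := by
  have h : HasDerivAt (fun y : ℝ => -(y - 0) ^ 2 / (2 * ((1 : NNReal) : ℝ))) (-x) x := by
    convert! ((((hasDerivAt_id x).sub_const 0).pow 2).neg).div_const (2 * ((1 : NNReal) : ℝ))
      using 1
    simp
    ring
  convert! h.exp.const_mul ((√(2 * Real.pi * ((1 : NNReal) : ℝ)))⁻¹) using 1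
  simp only [gaussianPDFReal]
  ring

theorem integral_mul_eval_gaussianReal (Q : ℝ[X]) :
    ∫ x, x * Q.eval x ∂(gaussianReal 0 1) = ∫ x, (derivative Q).eval x ∂(gaussianReal 0 1) := by
  have hparts := integral_mul_deriv_eq_deriv_mul_of_integrable
    (u := fun x => Q.eval x) (v := gaussianPDFReal 0 1)
    (u' := fun x => (derivative Q).eval x) (v' := fun x => -(x * gaussianPDFReal 0 1 x))
    (fun x _ => Q.hasDerivAt x) (fun x _ => hasDerivAt_gaussianPDFReal x)
    ((integrable_eval_mul_gaussianPDFReal (-(X * Q))).congr <| ae_of_all _ fun x => by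
      simp only [eval_neg, eval_mul, eval_X, Pi.mul_apply]; ring)
    (integrable_eval_mul_gaussianPDFReal _) (integrable_eval_mul_gaussianPDFReal _)
  simp_rw [integral_gaussianReal_eq_integral_smul one_ne_zero, smul_eq_mul]
  calc ∫ x, gaussianPDFReal 0 1 x * (x * Q.eval x)
      = -∫ x, Q.eval x * -(x * gaussianPDFReal 0 1 x) := by
        rw [← integral_neg]; congr 1 with x; ring
    _ = ∫ x, gaussianPDFReal 0 1 x * (derivative Q).eval x := by
        rw [hparts, neg_neg]; simp only [mul_comm]

theorem integral_mul_eval_affine_gaussianReal (Q : ℝ[X]) (a s : ℝ) :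
    ∫ z, z * Q.eval (a + s * z) ∂(gaussianReal 0 1)
      = s * ∫ z, (derivative Q).eval (a + s * z) ∂(gaussianReal 0 1) := by
  have h := integral_mul_eval_gaussianReal (Q.comp (C a + C s * X))
  simpa [derivative_comp, integral_const_mul] using h

theorem integrable_eval_affine_gaussianReal (Q : ℝ[X]) (a s : ℝ) :
    Integrable (fun z => Q.eval (a + s * z)) (gaussianReal 0 1) := by
  have h := integrable_eval_gaussianReal (Q.comp (C a + C s * X))
  simpa only [eval_comp, eval_add, eval_mul, eval_C, eval_X] using h

/-- The probabilists' Hermite polynomial `He_n`, with real coefficients. Mathlib's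
`Polynomial.hermite` has integer coefficients, but integration needs `He_n` over `ℝ`. -/
noncomputable def hermiteReal (n : ℕ) : ℝ[X] := (hermite n).map (Int.castRingHom ℝ)

theorem hermiteReal_zero : hermiteReal 0 = 1 := by simp [hermiteReal]

theorem hermiteReal_succ (n : ℕ) :
    hermiteReal (n + 1) = X * hermiteReal n - derivative (hermiteReal n) := by
  simp [hermiteReal, hermite_succ, derivative_map]

theorem hermiteReal_one : hermiteReal 1 = X := by simp [hermiteReal_succ, hermiteReal_zero]

theorem derivative_hermiteReal_succ (n : ℕ) :
    derivative (hermiteReal (n + 1)) = C (n + 1 : ℝ) * hermiteReal n := by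
  induction n with
  | zero => simp [hermiteReal_one, hermiteReal_zero]
  | succ n ih =>
    rw [hermiteReal_succ (n + 1), derivative_sub, derivative_mul, derivative_X, ih,
      derivative_C_mul, hermiteReal_succ n]
    push_cast [map_add, map_one]
    ring

theorem hermiteReal_add_two (n : ℕ) :
    hermiteReal (n + 2) = X * hermiteReal (n + 1) - C (n + 1 : ℝ) * hermiteReal n := by
  rw [hermiteReal_succ, derivative_hermiteReal_succ]

theorem integral_hermiteReal_succ_mul (n : ℕ) (Q : ℝ[X]) :
    ∫ x, (hermiteReal (n + 1)).eval x * Q.eval x ∂(gaussianReal 0 1)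
      = ∫ x, (hermiteReal n).eval x * (derivative Q).eval x ∂(gaussianReal 0 1) := by
  have hX := integrable_eval_gaussianReal (X * (hermiteReal n * Q))
  have hd := integrable_eval_gaussianReal (derivative (hermiteReal n) * Q)
  have hQ := integrable_eval_gaussianReal (hermiteReal n * derivative Q)
  have hstein := integral_mul_eval_gaussianReal (hermiteReal n * Q)
  simp only [derivative_mul, eval_mul, eval_add, eval_X] at hX hd hQ hstein
  rw [integral_add hd hQ] at hstein
  rw [← sub_eq_iff_eq_add'.mpr hstein, ← integral_sub hX hd]
  congr 1 with x
  simp only [hermiteReal_succ, eval_sub, eval_mul, eval_X]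
  ring

theorem integral_hermiteReal_mul (n m : ℕ) :
    ∫ x, (hermiteReal n).eval x * (hermiteReal m).eval x ∂(gaussianReal 0 1)
      = if n = m then (n.factorial : ℝ) else 0 := by
  induction n generalizing m with
  | zero =>
    cases m with
    | zero => simp [hermiteReal_zero]
    | succ m =>
      have h := integral_hermiteReal_succ_mul m 1
      simpa [hermiteReal_zero] using h
  | succ n ih =>
    rw [integral_hermiteReal_succ_mul]
    cases m with
    | zero => simp [hermiteReal_zero]
    | succ m =>
      simp_rw [derivative_hermiteReal_succ, eval_mul, eval_C, mul_left_comm _ ((m : ℝ) + 1)]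
      rw [integral_const_mul, ih]
      rcases eq_or_ne n m with rfl | hnm
      · simp [Nat.factorial_succ]
      · simp [hnm]

theorem integral_hermiteReal_add_two_affine (n : ℕ) (a s : ℝ) :
    ∫ z, (hermiteReal (n + 2)).eval (a + s * z) ∂(gaussianReal 0 1)
      = a * ∫ z, (hermiteReal (n + 1)).eval (a + s * z) ∂(gaussianReal 0 1)
        - (1 - s ^ 2) * (n + 1) * ∫ z, (hermiteReal n).eval (a + s * z) ∂(gaussianReal 0 1) := by
  have hstein := integral_mul_eval_affine_gaussianReal (hermiteReal (n + 1)) a s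
  have hX : Integrable (fun z => z * (hermiteReal (n + 1)).eval (a + s * z))
      (gaussianReal 0 1) := by
    have h := integrable_eval_gaussianReal (X * (hermiteReal (n + 1)).comp (C a + C s * X))
    simpa only [eval_comp, eval_add, eval_mul, eval_C, eval_X] using h
  have hn := integrable_eval_affine_gaussianReal (hermiteReal n) a s
  have hn' := integrable_eval_affine_gaussianReal (hermiteReal (n + 1)) a s
  simp only [derivative_hermiteReal_succ, eval_mul, eval_C, integral_const_mul] at hstein
  simp only [hermiteReal_add_two, eval_sub, eval_mul, eval_X, eval_C, add_mul a, mul_assoc s]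
  rw [integral_sub ((hn'.const_mul a).fun_add (hX.const_mul s)) (hn.const_mul _),
    integral_add (hn'.const_mul a) (hX.const_mul s)]
  simp only [integral_const_mul, hstein]
  ring

theorem integral_hermiteReal_affine {ρ s : ℝ} (h : ρ ^ 2 + s ^ 2 = 1) (x : ℝ) (n : ℕ) :
    ∫ z, (hermiteReal n).eval (ρ * x + s * z) ∂(gaussianReal 0 1)
      = ρ ^ n * (hermiteReal n).eval x := by
  induction n using Nat.twoStepInduction with
  | zero => simp [hermiteReal_zero]
  | one =>
    have hid : Integrable (fun z => z) (gaussianReal 0 1) := by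
      simpa only [eval_X] using integrable_eval_gaussianReal X
    simp only [hermiteReal_one, eval_X, pow_one]
    rw [integral_add (integrable_const _) (hid.const_mul s), integral_const_mul s,
      integral_id_gaussianReal]
    simp
  | more n ih ih' =>
    rw [integral_hermiteReal_add_two_affine, ih, ih', hermiteReal_add_two,
      show 1 - s ^ 2 = ρ ^ 2 by linarith]
    simp only [eval_sub, eval_mul, eval_X, eval_C]
    ring

end HermiteReal

section Completeness

variable {E : Type*} [NormedAddCommGroup E] [InnerProductSpace ℝ E] [MeasurableSpace E]
  {μ : Measure E} {h k : E → ℝ}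

theorem charFun_withDensity_ofReal (hk : Integrable k μ) (ξ : E) :
    charFun (μ.withDensity fun x => ENNReal.ofReal (k x)) ξ
      = ∫ x, ((max (k x) 0 : ℝ) : ℂ) * Complex.exp (inner ℝ x ξ * Complex.I) ∂μ := by
  rw [charFun_apply, integral_withDensity_eq_integral_toReal_smul₀
    hk.aemeasurable.ennreal_ofReal (by simp)]
  simp only [ENNReal.toReal_ofReal', Complex.real_smul]

variable [BorelSpace E]

theorem integrable_max_zero_mul_cexp_inner (hk : Integrable k μ) (ξ : E) :
    Integrable (fun x => ((max (k x) 0 : ℝ) : ℂ) * Complex.exp (inner ℝ x ξ * Complex.I)) μ := by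
  refine hk.pos_part.mono ((Complex.continuous_ofReal.comp_aestronglyMeasurable hk.pos_part.1).mul
    (Continuous.aestronglyMeasurable (by fun_prop))) (ae_of_all _ fun x => ?_)
  rw [norm_mul, Complex.norm_exp_ofReal_mul_I, mul_one, Complex.norm_real]

theorem ae_eq_zero_of_integral_mul_cexp_inner_eq_zero [SecondCountableTopology E] [CompleteSpace E]
    (hh : Integrable h μ)
    (h0 : ∀ ξ, ∫ x, (h x : ℂ) * Complex.exp (inner ℝ x ξ * Complex.I) ∂μ = 0) :
    h =ᵐ[μ] 0 := by
  have := isFiniteMeasure_withDensity_ofReal hh.2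
  have := isFiniteMeasure_withDensity_ofReal hh.neg.2
  have heq : μ.withDensity (fun x => ENNReal.ofReal (h x))
      = μ.withDensity (fun x => ENNReal.ofReal ((-h) x)) := by
    refine Measure.ext_of_charFun (funext fun ξ => sub_eq_zero.1 ?_)
    rw [charFun_withDensity_ofReal hh, charFun_withDensity_ofReal hh.neg,
      ← integral_sub (integrable_max_zero_mul_cexp_inner hh ξ)
        (integrable_max_zero_mul_cexp_inner hh.neg ξ), ← h0 ξ]
    congr 1 with x
    rw [← sub_mul, ← Complex.ofReal_sub, Pi.neg_apply, max_zero_sub_eq_self]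
  rw [withDensity_eq_iff hh.aemeasurable.ennreal_ofReal hh.neg.aemeasurable.ennreal_ofReal
    hh.lintegral_lt_top.ne] at heq
  filter_upwards [heq] with x hx
  rw [← max_zero_sub_eq_self (h x), ← ENNReal.toReal_ofReal', ← ENNReal.toReal_ofReal', hx,
    Pi.neg_apply, sub_self, Pi.zero_apply]

theorem integral_mul_cexp_inner_eq_zero
    (hexp : ∀ c : ℝ, Integrable (fun x => |h x| * Real.exp (c * ‖x‖)) μ)
    (hh : AEStronglyMeasurable h μ)
    (h0 : ∀ ξ : E, ∀ n : ℕ, ∫ x, h x * inner ℝ x ξ ^ n ∂μ = 0) (ξ : E) :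
    ∫ x, (h x : ℂ) * Complex.exp (inner ℝ x ξ * Complex.I) ∂μ = 0 := by
  set F : ℕ → E → ℂ := fun n x =>
    (h x : ℂ) * (((inner ℝ x ξ : ℝ) * Complex.I) ^ n / n.factorial) with hF
  set B : ℕ → E → ℝ := fun n x => |h x| * ((‖ξ‖ * ‖x‖) ^ n / n.factorial) with hB
  have hterm (n : ℕ) : ∫ x, F n x ∂μ = 0 := by
    calc ∫ x, F n x ∂μ
        = ∫ x, (Complex.I ^ n / n.factorial) * ((h x * inner ℝ x ξ ^ n : ℝ) : ℂ) ∂μ := by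
          congr 1 with x; simp only [hF]; push_cast; ring
      _ = 0 := by rw [integral_const_mul, integral_complex_ofReal, h0]; simp
  have hmeas (n : ℕ) : AEStronglyMeasurable (F n) μ :=
    (Complex.continuous_ofReal.comp_aestronglyMeasurable hh).mul
      (Continuous.aestronglyMeasurable (by fun_prop))
  have hFB (n : ℕ) (x : E) : ‖F n x‖ ≤ B n x := by
    have hinner : |inner ℝ x ξ| ≤ ‖ξ‖ * ‖x‖ := mul_comm ‖ξ‖ ‖x‖ ▸ abs_real_inner_le_norm x ξ
    simp only [hF, hB, norm_mul, norm_div, norm_pow, Complex.norm_real, Complex.norm_I, mul_one,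
      Complex.norm_natCast, Real.norm_eq_abs]
    gcongr
  have hBsum (x : E) : HasSum (fun n => B n x) (|h x| * Real.exp (‖ξ‖ * ‖x‖)) := by
    rw [Real.exp_eq_exp_ℝ]
    exact (NormedSpace.expSeries_div_hasSum_exp (‖ξ‖ * ‖x‖)).mul_left _
  have hFsum (x : E) :
      HasSum (fun n => F n x) (h x * Complex.exp ((inner ℝ x ξ : ℝ) * Complex.I)) := by
    rw [Complex.exp_eq_exp_ℂ]
    exact (NormedSpace.expSeries_div_hasSum_exp ((inner ℝ x ξ : ℝ) * Complex.I)).mul_left _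
  have hsum := hasSum_integral_of_dominated_convergence B hmeas
    (fun n => ae_of_all _ (hFB n)) (ae_of_all _ fun x => (hBsum x).summable)
    (by simpa only [fun x => (hBsum x).tsum_eq] using hexp ‖ξ‖) (ae_of_all _ hFsum)
  simp only [hterm] at hsum
  exact hsum.unique hasSum_zero

end Completeness

section GaussianMoments

variable {E : Type*} [NormedAddCommGroup E] [NormedSpace ℝ E] [MeasurableSpace E] [BorelSpace E]
  [SecondCountableTopology E] [CompleteSpace E] (μ : Measure E) [IsGaussian μ]

theorem integrable_exp_mul_norm (c : ℝ) : Integrable (fun x => Real.exp (c * ‖x‖)) μ := by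
  obtain ⟨a, ha, hint⟩ := IsGaussian.exists_integrable_exp_sq μ
  refine (hint.const_mul (Real.exp (c ^ 2 / (4 * a)))).mono' (by fun_prop) (ae_of_all _ fun x => ?_)
  have hsq : c * ‖x‖ ≤ c ^ 2 / (4 * a) + a * ‖x‖ ^ 2 := by
    rw [div_add' _ _ _ (by positivity), le_div_iff₀ (by positivity)]
    linarith [sq_nonneg (c - 2 * a * ‖x‖)]
  rwa [Real.norm_of_nonneg (Real.exp_pos _).le, ← Real.exp_add, Real.exp_le_exp]

theorem integrable_abs_mul_exp_mul_norm {h : E → ℝ} (hh : MemLp h 2 μ) (c : ℝ) :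
    Integrable (fun x => |h x| * Real.exp (c * ‖x‖)) μ := by
  refine hh.abs.integrable_mul ((memLp_two_iff_integrable_sq (by fun_prop)).2 ?_)
  simpa only [← Real.exp_nat_mul, mul_assoc] using integrable_exp_mul_norm μ ((2 : ℕ) * c)

end GaussianMoments

section HermiteMv

variable {d : ℕ}

local notation "𝕍" => EuclideanSpace ℝ (Fin d)
local notation "γ" => stdGaussian (EuclideanSpace ℝ (Fin d))

@[simp] theorem evalAt_C (a : ℝ) (x : 𝕍) : evalAt (MvPolynomial.C a) x = a := by simp [evalAt]

@[simp] theorem evalAt_one (x : 𝕍) : evalAt 1 x = 1 := by simp [evalAt]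

@[simp] theorem evalAt_X (i : Fin d) (x : 𝕍) : evalAt (MvPolynomial.X i) x = x i := by
  simp [evalAt]

@[simp] theorem evalAt_add (p q : MvPolynomial (Fin d) ℝ) (x : 𝕍) :
    evalAt (p + q) x = evalAt p x + evalAt q x := by simp [evalAt]

@[simp] theorem evalAt_mul (p q : MvPolynomial (Fin d) ℝ) (x : 𝕍) :
    evalAt (p * q) x = evalAt p x * evalAt q x := by simp [evalAt]

@[simp] theorem evalAt_pow (p : MvPolynomial (Fin d) ℝ) (n : ℕ) (x : 𝕍) :
    evalAt (p ^ n) x = evalAt p x ^ n := by simp [evalAt]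

theorem evalAt_sum {ι : Type*} (s : Finset ι) (p : ι → MvPolynomial (Fin d) ℝ) (x : 𝕍) :
    evalAt (∑ i ∈ s, p i) x = ∑ i ∈ s, evalAt (p i) x := by simp [evalAt]

theorem memLp_evalAt (p : MvPolynomial (Fin d) ℝ) {r : ENNReal} (hr : r ≠ ⊤) :
    MemLp (evalAt p) r γ := by
  induction p using MvPolynomial.induction_on generalizing r with
  | C a => simpa only [funext (evalAt_C (d := d) a)] using memLp_const a
  | add p q hp hq => simpa only [funext (evalAt_add p q)] using! (hp hr).add (hq hr)
  | mul_X p i hp =>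
    have h2r : 2 * r ≠ ⊤ := ENNReal.mul_ne_top (by simp) hr
    have hX : MemLp (fun x : 𝕍 => x i) (2 * r) γ :=
      (IsGaussian.memLp_id γ (2 * r) h2r).mono (by fun_prop)
        (ae_of_all _ fun x => PiLp.norm_apply_le x i)
    have : ENNReal.HolderTriple (2 * r) (2 * r) r := ⟨by
      rw [ENNReal.mul_inv (by simp) (by simp), ← add_mul, ENNReal.inv_two_add_inv_two, one_mul]⟩
    simpa only [funext (evalAt_mul p (MvPolynomial.X i)), evalAt_X] using! hX.mul (hp h2r)

theorem integrable_mul_evalAt {f : 𝕍 → ℝ} (hf : MemLp f 2 γ) (p : MvPolynomial (Fin d) ℝ) :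
    Integrable (fun x => f x * evalAt p x) γ :=
  hf.integrable_mul (memLp_evalAt p (r := 2) ENNReal.ofNat_ne_top)

theorem hermiteMv_eq_prod_hermiteReal (α : Fin d → ℕ) :
    hermiteMv α = ∏ i, Polynomial.aeval (MvPolynomial.X i) (hermiteReal (α i)) := by
  simp only [hermiteMv, hermiteReal, ← algebraMap_int_eq, Polynomial.aeval_map_algebraMap]

theorem hermiteMv_zero : hermiteMv (0 : Fin d → ℕ) = 1 := by simp [hermiteMv]

theorem evalAt_hermiteMv (α : Fin d → ℕ) (x : 𝕍) :
    evalAt (hermiteMv α) x = ∏ i, (hermiteReal (α i)).eval (x i) := by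
  simp only [evalAt, hermiteMv_eq_prod_hermiteReal, map_prod, ← MvPolynomial.coe_aeval_eq_eval,
    RingHom.coe_coe, ← Polynomial.aeval_algHom_apply, MvPolynomial.aeval_X,
    Polynomial.coe_aeval_eq_eval]

theorem integral_prod_stdGaussian (F : Fin d → ℝ → ℝ) :
    ∫ x, ∏ i, F i (x i) ∂γ = ∏ i, ∫ t, F i t ∂(gaussianReal 0 1) := by
  rw [← map_pi_eq_stdGaussian]
  exact ((MeasurableEquiv.toLp 2 (Fin d → ℝ)).measurableEmbedding.integral_map _).trans
    (integral_fintype_prod_eq_prod fun i t => F i t)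

theorem integral_hermiteMv_mul (α β : Fin d → ℕ) :
    ∫ x, evalAt (hermiteMv α) x * evalAt (hermiteMv β) x ∂γ
      = if α = β then ∏ i, ((α i).factorial : ℝ) else 0 := by
  simp_rw [evalAt_hermiteMv, ← Finset.prod_mul_distrib]
  rw [integral_prod_stdGaussian
    (fun i t => (hermiteReal (α i)).eval t * (hermiteReal (β i)).eval t)]
  simp_rw [integral_hermiteReal_mul]
  split_ifs with h
  · simp [h]
  · obtain ⟨i, hi⟩ := Function.ne_iff.1 h
    exact Finset.prod_eq_zero (Finset.mem_univ i) (if_neg hi)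

theorem integral_hermiteMv_affine {ρ s : ℝ} (h : ρ ^ 2 + s ^ 2 = 1) (α : Fin d → ℕ) (x : 𝕍) :
    ∫ z, evalAt (hermiteMv α) (ρ • x + s • z) ∂γ
      = ρ ^ (∑ i, α i) * evalAt (hermiteMv α) x := by
  simp only [evalAt_hermiteMv, PiLp.add_apply, PiLp.smul_apply, smul_eq_mul]
  rw [integral_prod_stdGaussian fun i t => (hermiteReal (α i)).eval (ρ * x i + s * t)]
  simp_rw [integral_hermiteReal_affine h]
  rw [Finset.prod_mul_distrib, Finset.prod_pow_eq_pow_sum]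

-- For `n = 0` the truncated index `n - 1 = 0` is harmless, as its coefficient vanishes.
theorem X_mul_hermiteReal (n : ℕ) : Polynomial.X * hermiteReal n
    = hermiteReal (n + 1) + Polynomial.C (n : ℝ) * hermiteReal (n - 1) := by
  cases n with
  | zero => simp [hermiteReal_one, hermiteReal_zero]
  | succ n => rw [hermiteReal_add_two, Nat.add_sub_cancel, Nat.cast_succ, sub_add_cancel]

theorem hermiteMv_update (i : Fin d) (α : Fin d → ℕ) (n : ℕ) :
    hermiteMv (Function.update α i n) = Polynomial.aeval (MvPolynomial.X i) (hermiteReal n) *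
      ∏ j ∈ Finset.univ.erase i, Polynomial.aeval (MvPolynomial.X j) (hermiteReal (α j)) := by
  rw [hermiteMv_eq_prod_hermiteReal, ← Finset.mul_prod_erase _ _ (Finset.mem_univ i),
    Function.update_self]
  congr 1
  exact Finset.prod_congr rfl fun j hj => by
    rw [Function.update_of_ne (Finset.ne_of_mem_erase hj)]

theorem X_mul_hermiteMv (i : Fin d) (α : Fin d → ℕ) :
    MvPolynomial.X i * hermiteMv α
      = hermiteMv (Function.update α i (α i + 1))
        + (α i : ℝ) • hermiteMv (Function.update α i (α i - 1)) := by
  have hX := congrArg (Polynomial.aeval (MvPolynomial.X i : MvPolynomial (Fin d) ℝ))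
    (X_mul_hermiteReal (α i))
  simp only [map_mul, map_add, Polynomial.aeval_X, Polynomial.aeval_C] at hX
  conv_lhs => rw [← Function.update_eq_self i α]
  rw [hermiteMv_update, hermiteMv_update, hermiteMv_update, ← mul_assoc, hX, add_mul, mul_assoc,
    Algebra.smul_def]

theorem mul_X_mem_span_hermiteMv {p : MvPolynomial (Fin d) ℝ}
    (hp : p ∈ Submodule.span ℝ (Set.range (hermiteMv (d := d)))) (i : Fin d) :
    p * MvPolynomial.X i ∈ Submodule.span ℝ (Set.range (hermiteMv (d := d))) := by
  induction hp using Submodule.span_induction with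
  | mem p hp =>
    obtain ⟨α, rfl⟩ := hp
    rw [mul_comm, X_mul_hermiteMv]
    exact add_mem (Submodule.subset_span ⟨_, rfl⟩)
      (Submodule.smul_mem _ _ (Submodule.subset_span ⟨_, rfl⟩))
  | zero => simp
  | add p q _ _ hp hq => rw [add_mul]; exact add_mem hp hq
  | smul a p _ hp => rw [smul_mul_assoc]; exact Submodule.smul_mem _ _ hp

theorem span_hermiteMv : Submodule.span ℝ (Set.range (hermiteMv (d := d))) = ⊤ := by
  refine eq_top_iff.2 fun p _ => ?_
  induction p using MvPolynomial.induction_on with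
  | C a =>
    rw [MvPolynomial.C_eq_smul_one, ← hermiteMv_zero]
    exact Submodule.smul_mem _ _ (Submodule.subset_span ⟨0, rfl⟩)
  | add p q hp hq => exact add_mem (hp trivial) (hq trivial)
  | mul_X p i hp => exact mul_X_mem_span_hermiteMv (hp trivial) i

end HermiteMv

section HermiteExpansion

variable {d : ℕ}

local notation "𝕍" => EuclideanSpace ℝ (Fin d)
local notation "γ" => stdGaussian (EuclideanSpace ℝ (Fin d))

theorem prod_factorial_pos (α : Fin d → ℕ) : (0 : ℝ) < ∏ i, ((α i).factorial : ℝ) :=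
  Finset.prod_pos fun i _ => by positivity

theorem integral_mul_hermiteMv (f : 𝕍 → ℝ) (α : Fin d → ℕ) :
    ∫ x, f x * evalAt (hermiteMv α) x ∂γ = (∏ i, ((α i).factorial : ℝ)) * hermiteCoeff f α :=
  (mul_div_cancel₀ _ (prod_factorial_pos α).ne').symm

theorem hermiteCoeff_zero (f : 𝕍 → ℝ) : hermiteCoeff f 0 = ∫ x, f x ∂γ := by
  simp [hermiteCoeff, hermiteMv_zero]

theorem hermiteCoeff_sub {f g : 𝕍 → ℝ} (hf : MemLp f 2 γ) (hg : MemLp g 2 γ) (α : Fin d → ℕ) :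
    hermiteCoeff (f - g) α = hermiteCoeff f α - hermiteCoeff g α := by
  simp only [hermiteCoeff, Pi.sub_apply, sub_mul]
  rw [integral_sub (integrable_mul_evalAt hf _) (integrable_mul_evalAt hg _), sub_div]

theorem integral_mul_evalAt_eq_zero {f : 𝕍 → ℝ} (hf : MemLp f 2 γ)
    (h0 : ∀ α, hermiteCoeff f α = 0) (p : MvPolynomial (Fin d) ℝ) :
    ∫ x, f x * evalAt p x ∂γ = 0 := by
  have hp : p ∈ Submodule.span ℝ (Set.range (hermiteMv (d := d))) := by simp [span_hermiteMv]
  induction hp using Submodule.span_induction with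
  | mem q hq =>
    obtain ⟨α, rfl⟩ := hq
    rw [integral_mul_hermiteMv, h0, mul_zero]
  | zero => simp [evalAt]
  | add p q _ _ hp hq =>
    simp_rw [evalAt_add, mul_add]
    rw [integral_add (integrable_mul_evalAt hf p) (integrable_mul_evalAt hf q), hp, hq, add_zero]
  | smul a q _ hq =>
    simp_rw [MvPolynomial.smul_eq_C_mul, evalAt_mul, evalAt_C, mul_left_comm _ a]
    rw [integral_const_mul, hq, mul_zero]

theorem ae_eq_zero_of_hermiteCoeff_eq_zero {f : 𝕍 → ℝ} (hf : MemLp f 2 γ)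
    (h0 : ∀ α, hermiteCoeff f α = 0) : f =ᵐ[γ] 0 := by
  refine ae_eq_zero_of_integral_mul_cexp_inner_eq_zero (hf.integrable (by simp))
    (integral_mul_cexp_inner_eq_zero (integrable_abs_mul_exp_mul_norm γ hf) hf.1 fun ξ n => ?_)
  have hpow (x : 𝕍) :
      evalAt ((∑ i, MvPolynomial.C (ξ i) * MvPolynomial.X i) ^ n) x = inner ℝ x ξ ^ n := by
    simp [evalAt_sum, PiLp.inner_apply]
  simp_rw [← hpow]
  exact integral_mul_evalAt_eq_zero hf h0 _

theorem inner_toLp_toLp {f g : 𝕍 → ℝ} (hf : MemLp f 2 γ) (hg : MemLp g 2 γ) :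
    inner ℝ (hf.toLp f) (hg.toLp g) = ∫ x, f x * g x ∂γ := by
  rw [L2.inner_def]
  refine integral_congr_ae ?_
  filter_upwards [hf.coeFn_toLp, hg.coeFn_toLp] with x hfx hgx
  simp [hfx, hgx, mul_comm]

/-- The class in `L²(γ_d)` of the normalised Hermite polynomial `hermiteMv α / √(α!)`. -/
noncomputable def hermiteLp (α : Fin d → ℕ) : Lp ℝ 2 γ :=
  (√(∏ i, ((α i).factorial : ℝ)))⁻¹ • (memLp_evalAt (hermiteMv α) ENNReal.ofNat_ne_top).toLp _

theorem inner_toLp_hermiteLp {f : 𝕍 → ℝ} (hf : MemLp f 2 γ) (α : Fin d → ℕ) :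
    inner ℝ (hf.toLp f) (hermiteLp α) = √(∏ i, ((α i).factorial : ℝ)) * hermiteCoeff f α := by
  rw [hermiteLp, inner_smul_right, inner_toLp_toLp, integral_mul_hermiteMv, ← mul_assoc,
    inv_mul_eq_div, Real.div_sqrt]

theorem orthonormal_hermiteLp : Orthonormal ℝ (hermiteLp (d := d)) := by
  rw [orthonormal_iff_ite]
  intro α β
  rw [hermiteLp, hermiteLp, inner_smul_left, inner_smul_right, inner_toLp_toLp,
    integral_hermiteMv_mul, conj_trivial]
  split_ifs with h
  · subst h
    rw [inv_mul_eq_div, inv_mul_eq_div, Real.div_sqrt,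
      div_self (Real.sqrt_pos.2 (prod_factorial_pos α)).ne']
  · simp

theorem orthogonal_span_hermiteLp : (Submodule.span ℝ (Set.range (hermiteLp (d := d))))ᗮ = ⊥ := by
  refine eq_bot_iff.2 fun u hu => (Submodule.mem_bot ℝ).2 ?_
  have hmem := Lp.memLp u
  have hcoeff (α : Fin d → ℕ) : hermiteCoeff u α = 0 := by
    have h := (Submodule.mem_orthogonal' _ _).1 hu _ (Submodule.subset_span ⟨α, rfl⟩)
    rw [← Lp.toLp_coeFn u hmem, inner_toLp_hermiteLp] at h
    exact (mul_eq_zero.1 h).resolve_left (Real.sqrt_pos.2 (prod_factorial_pos α)).ne'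
  exact Lp.ext ((ae_eq_zero_of_hermiteCoeff_eq_zero hmem hcoeff).trans (Lp.coeFn_zero _ _ _).symm)

/-- The normalised Hermite polynomials as a Hilbert basis of `L²(γ_d)`. -/
noncomputable def hermiteBasis : HilbertBasis (Fin d → ℕ) ℝ (Lp ℝ 2 γ) :=
  HilbertBasis.mkOfOrthogonalEqBot orthonormal_hermiteLp orthogonal_span_hermiteLp

theorem coe_hermiteBasis : ⇑(hermiteBasis (d := d)) = hermiteLp :=
  HilbertBasis.coe_mkOfOrthogonalEqBot _ _

theorem hasSum_hermiteCoeff_sq {f : 𝕍 → ℝ} (hf : MemLp f 2 γ) :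
    HasSum (fun α => (∏ i, ((α i).factorial : ℝ)) * hermiteCoeff f α ^ 2) (∫ x, f x ^ 2 ∂γ) := by
  have h := (hermiteBasis (d := d)).hasSum_inner_mul_inner (hf.toLp f) (hf.toLp f)
  simp_rw [real_inner_comm (hf.toLp f) (hermiteBasis _), coe_hermiteBasis, inner_toLp_hermiteLp,
    inner_toLp_toLp, ← pow_two, mul_pow] at h
  simpa only [Real.sq_sqrt (prod_factorial_pos _).le] using h

theorem integral_sq_le_of_abs_hermiteCoeff_le {f g : 𝕍 → ℝ} (hf : MemLp f 2 γ)
    (hg : MemLp g 2 γ) {c : ℝ} (h : ∀ α, |hermiteCoeff f α| ≤ c * |hermiteCoeff g α|) :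
    ∫ x, f x ^ 2 ∂γ ≤ c ^ 2 * ∫ x, g x ^ 2 ∂γ := by
  refine hasSum_le (fun α => ?_) (hasSum_hermiteCoeff_sq hf)
    ((hasSum_hermiteCoeff_sq hg).mul_left (c ^ 2))
  have hα := pow_le_pow_left₀ (abs_nonneg _) (h α) 2
  rw [mul_pow, sq_abs, sq_abs] at hα
  rw [mul_left_comm]
  gcongr

end HermiteExpansion

section Rotation

open ContinuousLinearMap (rotation)

variable {E : Type*} [NormedAddCommGroup E] [NormedSpace ℝ E]

theorem rotation_zero (w : E × E) : rotation 0 w = w := by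
  simp [ContinuousLinearMap.rotation_apply]

theorem rotation_rotation (a b : ℝ) (w : E × E) :
    rotation a (rotation b w) = rotation (a + b) w := by
  ext <;> simp only [ContinuousLinearMap.rotation_apply, Real.cos_add, Real.sin_add] <;> module

variable [MeasurableSpace E] [BorelSpace E] [SecondCountableTopology E] [CompleteSpace E]
  {μ : Measure E} [IsGaussian μ]

theorem measurePreserving_rotation (hμ : μ[id] = 0) (θ : ℝ) :
    MeasurePreserving (rotation θ : E × E →L[ℝ] E × E) (μ.prod μ) (μ.prod μ) :=
  ⟨by fun_prop, IsGaussian.map_rotation_eq_self hμ θ⟩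

theorem integral_comp_rotation (hμ : μ[id] = 0) (θ : ℝ) {F : E × E → ℝ}
    (hF : AEStronglyMeasurable F (μ.prod μ)) :
    ∫ w, F (rotation θ w) ∂(μ.prod μ) = ∫ w, F w ∂(μ.prod μ) := by
  have hθ := measurePreserving_rotation hμ θ
  conv_rhs => rw [← hθ.map_eq]
  rw [integral_map hθ.measurable.aemeasurable (by rwa [hθ.map_eq])]

theorem memLp_comp_rotation_fst (hμ : μ[id] = 0) (θ : ℝ) {f : E → ℝ} {p : ENNReal}
    (hf : MemLp f p μ) : MemLp (fun w : E × E => f (rotation θ w).1) p (μ.prod μ) :=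
  (hf.comp_fst μ).comp_measurePreserving (measurePreserving_rotation hμ θ)

theorem integral_rotation_fst_mul (hμ : μ[id] = 0) (θ : ℝ) {f g : E → ℝ}
    (hf : MemLp f 2 μ) (hg : MemLp g 2 μ) :
    ∫ x, (∫ z, f (rotation θ (x, z)).1 ∂μ) * g x ∂μ
      = ∫ x, f x * ∫ z, g (rotation (-θ) (x, z)).1 ∂μ ∂μ := by
  have hfg : Integrable (fun w : E × E => f (rotation θ w).1 * g w.1) (μ.prod μ) :=
    (memLp_comp_rotation_fst hμ θ hf).integrable_mul (hg.comp_fst μ)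
  have hgf : Integrable (fun w : E × E => f w.1 * g (rotation (-θ) w).1) (μ.prod μ) :=
    (hf.comp_fst μ).integrable_mul (memLp_comp_rotation_fst hμ (-θ) hg)
  calc ∫ x, (∫ z, f (rotation θ (x, z)).1 ∂μ) * g x ∂μ
      = ∫ w, f (rotation θ w).1 * g w.1 ∂(μ.prod μ) := by
        simp_rw [integral_prod _ hfg, integral_mul_const]
    _ = ∫ w, f w.1 * g (rotation (-θ) w).1 ∂(μ.prod μ) := by
        simp_rw [← integral_comp_rotation hμ θ hgf.1, rotation_rotation, neg_add_cancel,
          rotation_zero]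
    _ = ∫ x, f x * ∫ z, g (rotation (-θ) (x, z)).1 ∂μ ∂μ := by
        simp_rw [integral_prod _ hgf, integral_const_mul]

end Rotation

section Jensen

variable {Ω Ω' : Type*} [MeasurableSpace Ω] [MeasurableSpace Ω'] {μ : Measure Ω}
  {ν : Measure Ω'} [IsProbabilityMeasure ν]

theorem sq_integral_le_integral_sq {u : Ω' → ℝ} (hu : MemLp u 2 ν) :
    (∫ x, u x ∂ν) ^ 2 ≤ ∫ x, u x ^ 2 ∂ν := by
  have hvar := variance_nonneg u ν
  rw [variance_eq_sub hu] at hvar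
  simpa only [Pi.pow_apply] using sub_nonneg.1 hvar

theorem integral_abs_le_of_integral_sq_le {u : Ω' → ℝ} (hu : MemLp u 2 ν) {c : ℝ} (hc : 0 ≤ c)
    (h : ∫ x, u x ^ 2 ∂ν ≤ c ^ 2) : ∫ x, |u x| ∂ν ≤ c := by
  have hsq := sq_integral_le_integral_sq hu.abs
  simp only [Pi.abs_apply, sq_abs] at hsq
  exact le_of_sq_le_sq (hsq.trans h) hc

theorem memLp_two_integral_prod [SFinite μ] {F : Ω × Ω' → ℝ} (hF : MemLp F 2 (μ.prod ν)) :
    MemLp (fun x => ∫ y, F (x, y) ∂ν) 2 μ := by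
  have hmeas := hF.1.integral_prod_right'
  refine (memLp_two_iff_integrable_sq hmeas).2
    (hF.integrable_sq.integral_prod_left.mono' (hmeas.pow 2) ?_)
  filter_upwards [hF.1.prodMk_left, hF.integrable_sq.prod_right_ae] with x hx hx2
  rw [Real.norm_of_nonneg (sq_nonneg _)]
  exact sq_integral_le_integral_sq ((memLp_two_iff_integrable_sq hx).2 hx2)

end Jensen

section Smoothing

open ContinuousLinearMap (rotation)

variable {d : ℕ} {ρ : ℝ}

local notation "𝕍" => EuclideanSpace ℝ (Fin d)
local notation "γ" => stdGaussian (EuclideanSpace ℝ (Fin d))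

theorem ornsteinUhlenbeck_eq_integral_rotation (h1 : -1 ≤ ρ) (h2 : ρ ≤ 1) (f : 𝕍 → ℝ) (x : 𝕍) :
    ornsteinUhlenbeck ρ f x = ∫ z, f (rotation (Real.arccos ρ) (x, z)).1 ∂γ := by
  simp only [ornsteinUhlenbeck, ContinuousLinearMap.rotation_apply, Real.cos_arccos h1 h2,
    Real.sin_arccos]

theorem memLp_ornsteinUhlenbeck (h1 : -1 ≤ ρ) (h2 : ρ ≤ 1) {f : 𝕍 → ℝ} (hf : MemLp f 2 γ) :
    MemLp (ornsteinUhlenbeck ρ f) 2 γ := by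
  simp_rw [funext (ornsteinUhlenbeck_eq_integral_rotation h1 h2 f)]
  exact memLp_two_integral_prod (memLp_comp_rotation_fst (by simp) _ hf)

theorem hermiteCoeff_ornsteinUhlenbeck (h1 : -1 ≤ ρ) (h2 : ρ ≤ 1) {f : 𝕍 → ℝ}
    (hf : MemLp f 2 γ) (α : Fin d → ℕ) :
    hermiteCoeff (ornsteinUhlenbeck ρ f) α = ρ ^ (∑ i, α i) * hermiteCoeff f α := by
  have heigen (x : 𝕍) :
      ∫ z, evalAt (hermiteMv α) (rotation (-Real.arccos ρ) (x, z)).1 ∂γ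
        = ρ ^ (∑ i, α i) * evalAt (hermiteMv α) x := by
    simp only [ContinuousLinearMap.rotation_apply, Real.cos_neg, Real.cos_arccos h1 h2]
    refine integral_hermiteMv_affine ?_ α x
    rw [← Real.cos_sq_add_sin_sq (-Real.arccos ρ), Real.cos_neg, Real.cos_arccos h1 h2]
  simp_rw [hermiteCoeff, ornsteinUhlenbeck_eq_integral_rotation h1 h2]
  rw [integral_rotation_fst_mul (by simp) _ hf (memLp_evalAt _ ENNReal.ofNat_ne_top)]
  simp_rw [heigen, mul_left_comm _ (ρ ^ _), integral_const_mul, mul_div_assoc]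

theorem evalAt_hermiteTrunc (t : ℕ) (f : 𝕍 → ℝ) (x : 𝕍) :
    evalAt (hermiteTrunc t f) x = ∑ k ∈ Finset.range (t + 1),
      ∑ α ∈ Finset.piAntidiag (Finset.univ : Finset (Fin d)) k,
        hermiteCoeff f α * evalAt (hermiteMv α) x := by
  simp [hermiteTrunc, evalAt_sum]

theorem hermiteCoeff_hermiteTrunc (t : ℕ) (f : 𝕍 → ℝ) (β : Fin d → ℕ) :
    hermiteCoeff (evalAt (hermiteTrunc t f)) β
      = if ∑ i, β i ≤ t then hermiteCoeff f β else 0 := by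
  have hint (α : Fin d → ℕ) : Integrable (fun x => hermiteCoeff f α *
      (evalAt (hermiteMv α) x * evalAt (hermiteMv β) x)) γ :=
    (integrable_mul_evalAt (memLp_evalAt _ ENNReal.ofNat_ne_top) _).const_mul _
  rw [hermiteCoeff, div_eq_iff (prod_factorial_pos β).ne', ite_mul, zero_mul]
  simp_rw [evalAt_hermiteTrunc, Finset.sum_mul, mul_assoc]
  rw [integral_finsetSum _ fun k _ => integrable_finsetSum _ fun α _ => hint α]
  simp_rw [fun k => integral_finsetSum (Finset.piAntidiag (Finset.univ : Finset (Fin d)) k)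
    fun α _ => hint α, integral_const_mul, integral_hermiteMv_mul]
  simp only [mul_ite, mul_zero, Finset.sum_ite_eq', Finset.mem_piAntidiag, Finset.mem_univ,
    implies_true, and_true, Finset.sum_ite_eq, Finset.mem_range, Nat.lt_succ_iff]

theorem totalDegree_aeval_X_le {σ R S : Type*} [CommSemiring R] [CommSemiring S] [Algebra S R]
    (i : σ) (P : Polynomial S) :
    (Polynomial.aeval (MvPolynomial.X i : MvPolynomial σ R) P).totalDegree ≤ P.natDegree := by
  rw [Polynomial.aeval_eq_sum_range]
  refine MvPolynomial.totalDegree_finsetSum_le fun k hk =>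
    (MvPolynomial.totalDegree_smul_le _ _).trans ?_
  rw [MvPolynomial.X_pow_eq_monomial]
  refine (MvPolynomial.totalDegree_monomial_le _ _).trans ?_
  rw [Finsupp.sum_single_index rfl]
  exact Nat.lt_succ_iff.1 (Finset.mem_range.1 hk)

theorem totalDegree_hermiteMv_le (α : Fin d → ℕ) : (hermiteMv α).totalDegree ≤ ∑ i, α i :=
  (MvPolynomial.totalDegree_finsetProd _ _).trans <| Finset.sum_le_sum fun i _ =>
    (totalDegree_aeval_X_le i _).trans Polynomial.natDegree_hermite.le

theorem totalDegree_hermiteTrunc_le (t : ℕ) (f : 𝕍 → ℝ) : (hermiteTrunc t f).totalDegree ≤ t := by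
  refine MvPolynomial.totalDegree_finsetSum_le fun k hk =>
    MvPolynomial.totalDegree_finsetSum_le fun α hα => ?_
  calc (MvPolynomial.C (hermiteCoeff f α) * hermiteMv α).totalDegree
      ≤ (hermiteMv α).totalDegree := by
        simpa using MvPolynomial.totalDegree_mul (MvPolynomial.C (hermiteCoeff f α)) (hermiteMv α)
    _ ≤ ∑ i, α i := totalDegree_hermiteMv_le α
    _ ≤ t := (Finset.mem_piAntidiag.1 hα).1 ▸ Nat.lt_succ_iff.1 (Finset.mem_range.1 hk)

theorem integral_hermiteTrunc_ornsteinUhlenbeck (h1 : -1 ≤ ρ) (h2 : ρ ≤ 1) {f : 𝕍 → ℝ}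
    (hf : MemLp f 2 γ) (t : ℕ) :
    ∫ x, evalAt (hermiteTrunc t (ornsteinUhlenbeck ρ f)) x ∂γ = ∫ x, f x ∂γ := by
  simp [← hermiteCoeff_zero, hermiteCoeff_hermiteTrunc, hermiteCoeff_ornsteinUhlenbeck h1 h2 hf]

theorem integral_sq_hermiteTrunc_ornsteinUhlenbeck_le (h1 : -1 ≤ ρ) (h2 : ρ ≤ 1) {f : 𝕍 → ℝ}
    (hf : MemLp f 2 γ) (t : ℕ) :
    ∫ x, evalAt (hermiteTrunc t (ornsteinUhlenbeck ρ f)) x ^ 2 ∂γ ≤ ∫ x, f x ^ 2 ∂γ := by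
  have h := integral_sq_le_of_abs_hermiteCoeff_le (c := 1)
    (memLp_evalAt (hermiteTrunc t (ornsteinUhlenbeck ρ f)) ENNReal.ofNat_ne_top) hf fun α => by
      rw [hermiteCoeff_hermiteTrunc, hermiteCoeff_ornsteinUhlenbeck h1 h2 hf, one_mul]
      split_ifs
      · rw [abs_mul, abs_pow]
        exact mul_le_of_le_one_left (abs_nonneg _)
          (pow_le_one₀ (abs_nonneg _) (abs_le.2 ⟨h1, h2⟩))
      · simp
  rwa [one_pow, one_mul] at h

theorem integral_sq_hermiteTrunc_sub_ornsteinUhlenbeck_le (h0 : 0 ≤ ρ) (h1 : ρ ≤ 1) {f : 𝕍 → ℝ}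
    (hf : MemLp f 2 γ) (t : ℕ) :
    ∫ x, (evalAt (hermiteTrunc t (ornsteinUhlenbeck ρ f)) x - ornsteinUhlenbeck ρ f x) ^ 2 ∂γ
      ≤ (ρ ^ (t + 1)) ^ 2 * ∫ x, f x ^ 2 ∂γ := by
  have hρ : -1 ≤ ρ := by linarith
  have hp := memLp_evalAt (hermiteTrunc t (ornsteinUhlenbeck ρ f)) (r := 2) ENNReal.ofNat_ne_top
  have hT := memLp_ornsteinUhlenbeck hρ h1 hf
  refine integral_sq_le_of_abs_hermiteCoeff_le (hp.sub hT) hf fun α => ?_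
  rw [hermiteCoeff_sub hp hT, hermiteCoeff_hermiteTrunc, hermiteCoeff_ornsteinUhlenbeck hρ h1 hf]
  split_ifs with hα
  · rw [sub_self, abs_zero]
    positivity
  · rw [zero_sub, abs_neg, abs_mul, abs_pow, abs_of_nonneg h0]
    exact mul_le_mul_of_nonneg_right (pow_le_pow_of_le_one h0 h1 (by omega)) (abs_nonneg _)

end Smoothing

section RotationVariation

open ContinuousLinearMap (rotation)

variable {E : Type*} [NormedAddCommGroup E] [NormedSpace ℝ E]

theorem norm_rotation_fst_sub_le (s : ℝ) (w : E × E) :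
    ‖(rotation s w).1 - w.1‖ ≤ |s| * (‖w.1‖ + ‖w.2‖) := by
  have hcos : |Real.cos s - 1| ≤ |s| := by simpa using Real.abs_cos_sub_cos_le s 0
  have hsin : |Real.sin s| ≤ |s| := Real.abs_sin_le_abs
  calc ‖(rotation s w).1 - w.1‖
      = ‖(Real.cos s - 1) • w.1 + Real.sin s • w.2‖ := by
        rw [ContinuousLinearMap.rotation_apply]
        congr 1
        module
    _ ≤ |Real.cos s - 1| * ‖w.1‖ + |Real.sin s| * ‖w.2‖ := by
        simpa only [norm_smul, Real.norm_eq_abs] using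
          norm_add_le ((Real.cos s - 1) • w.1) (Real.sin s • w.2)
    _ ≤ |s| * (‖w.1‖ + ‖w.2‖) := by
        rw [mul_add]
        gcongr

theorem hasDerivAt_rotation_fst (w : E × E) : HasDerivAt (fun s => (rotation s w).1) w.2 0 := by
  simpa [ContinuousLinearMap.rotation_apply] using
    ((Real.hasDerivAt_cos 0).smul_const w.1).fun_add ((Real.hasDerivAt_sin 0).smul_const w.2)

theorem tendsto_nat_mul_abs_rotation_fst_sub {g : E → ℝ} {w : E × E}
    (hg : DifferentiableAt ℝ g w.1) (θ : ℝ) :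
    Tendsto (fun n : ℕ => n * |g (rotation (θ / n) w).1 - g w.1|) atTop
      (𝓝 |θ * fderiv ℝ g w.1 w.2|) := by
  have hw : (rotation (θ * 0) w).1 = w.1 := by rw [mul_zero, rotation_zero]
  have hderiv : HasDerivAt (fun r => g (rotation (θ * r) w).1) (θ * fderiv ℝ g w.1 w.2) 0 := by
    have hrot : HasDerivAt (fun r => (rotation (θ * r) w).1) (θ • w.2) 0 :=
      HasDerivAt.scomp (g₁ := fun s => (rotation s w).1) 0
        (by simpa only [mul_zero] using hasDerivAt_rotation_fst w) (hasDerivAt_const_mul θ)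
    have hg' : HasFDerivAt g (fderiv ℝ g w.1) (rotation (θ * 0) w).1 := hw ▸ hg.hasFDerivAt
    rw [← smul_eq_mul, ← map_smul]
    exact hg'.comp_hasDerivAt 0 hrot
  have hseq : Tendsto (fun n : ℕ => (n : ℝ)⁻¹) atTop (𝓝[≠] 0) :=
    (tendsto_inv_atTop_nhdsGT_zero.mono_right (nhdsGT_le_nhdsNE 0)).comp
      tendsto_natCast_atTop_atTop
  refine (hderiv.tendsto_slope_zero.comp hseq).abs.congr fun n => ?_
  simp only [Function.comp_apply, inv_inv, smul_eq_mul, zero_add, hw, abs_mul, Nat.abs_cast,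
    div_eq_mul_inv]

variable [MeasurableSpace E] [BorelSpace E] [SecondCountableTopology E]

/-- The mean oscillation of `g` along a rotation by the angle `θ` of two independent copies of
`μ`. For `g = 1_H` this is the noise sensitivity of `H`: the probability that exactly one of
`x` and `cos θ • x + sin θ • z` lies in `H`. -/
noncomputable def rotationVariation (μ : Measure E) (g : E → ℝ) (θ : ℝ) : ℝ :=
  ∫ w, |g (rotation θ w).1 - g w.1| ∂(μ.prod μ)

variable [CompleteSpace E] {μ : Measure E} [IsGaussian μ] {f g : E → ℝ}

theorem integrable_comp_rotation_fst (hμ : μ[id] = 0) (θ : ℝ) (hg : Integrable g μ) :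
    Integrable (fun w : E × E => g (rotation θ w).1) (μ.prod μ) :=
  memLp_one_iff_integrable.1
    (memLp_comp_rotation_fst hμ θ (memLp_one_iff_integrable.2 hg))

theorem integrable_rotationVariation (hμ : μ[id] = 0) (hg : Integrable g μ) (θ : ℝ) :
    Integrable (fun w : E × E => |g (rotation θ w).1 - g w.1|) (μ.prod μ) :=
  ((integrable_comp_rotation_fst hμ θ hg).sub (hg.comp_fst μ)).abs

theorem rotationVariation_add_le (hμ : μ[id] = 0) (hg : Integrable g μ) (a b : ℝ) :
    rotationVariation μ g (a + b) ≤ rotationVariation μ g a + rotationVariation μ g b := by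
  have ha := integrable_rotationVariation hμ hg a
  have hab : Integrable (fun w : E × E => |g (rotation (a + b) w).1 - g (rotation b w).1|)
      (μ.prod μ) :=
    ((integrable_comp_rotation_fst hμ _ hg).sub (integrable_comp_rotation_fst hμ _ hg)).abs
  have hstep : ∫ w, |g (rotation (a + b) w).1 - g (rotation b w).1| ∂(μ.prod μ)
      = rotationVariation μ g a := by
    simp_rw [← rotation_rotation a b]
    exact integral_comp_rotation hμ b ha.1
  rw [← hstep, rotationVariation, rotationVariation,
    ← integral_add hab (integrable_rotationVariation hμ hg b)]
  exact integral_mono (integrable_rotationVariation hμ hg _)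
    (hab.add (integrable_rotationVariation hμ hg b)) fun w => abs_sub_le _ _ _

theorem rotationVariation_nat_mul_le (hμ : μ[id] = 0) (hg : Integrable g μ) (n : ℕ) (θ : ℝ) :
    rotationVariation μ g (n * θ) ≤ n * rotationVariation μ g θ := by
  induction n with
  | zero => simp [rotationVariation, rotation_zero]
  | succ n ih =>
    rw [Nat.cast_succ, add_one_mul, add_one_mul]
    exact (rotationVariation_add_le hμ hg _ _).trans (by gcongr)

theorem rotationVariation_le_add_integral_abs_sub (hμ : μ[id] = 0) (hf : Integrable f μ)
    (hg : Integrable g μ) (θ : ℝ) :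
    rotationVariation μ f θ ≤ rotationVariation μ g θ + 2 * ∫ x, |f x - g x| ∂μ := by
  have hfst : Integrable (fun w : E × E => |f w.1 - g w.1|) (μ.prod μ) :=
    (hf.sub hg).abs.comp_fst μ
  have hrot : Integrable (fun w : E × E => |f (rotation θ w).1 - g (rotation θ w).1|)
      (μ.prod μ) := integrable_comp_rotation_fst hμ θ (hf.sub hg).abs
  have hg' := integrable_rotationVariation hμ hg θ
  have hfst_eq : ∫ w, |f w.1 - g w.1| ∂(μ.prod μ) = ∫ x, |f x - g x| ∂μ := by
    rw [integral_fun_fst (fun x => |f x - g x|), probReal_univ, one_smul]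
  have hrot_eq : ∫ w, |f (rotation θ w).1 - g (rotation θ w).1| ∂(μ.prod μ)
      = ∫ x, |f x - g x| ∂μ := by
    rw [← hfst_eq, ← integral_comp_rotation hμ θ hfst.1]
  calc rotationVariation μ f θ
      ≤ ∫ w, (|g (rotation θ w).1 - g w.1|
          + (|f (rotation θ w).1 - g (rotation θ w).1| + |f w.1 - g w.1|)) ∂(μ.prod μ) := by
        refine integral_mono (integrable_rotationVariation hμ hf θ)
          (hg'.add (hrot.add hfst)) fun w => ?_
        have h1 := abs_sub_le (f (rotation θ w).1) (g (rotation θ w).1) (f w.1)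
        have h2 := abs_sub_le (g (rotation θ w).1) (g w.1) (f w.1)
        rw [abs_sub_comm (g w.1) (f w.1)] at h2
        linarith
    _ = rotationVariation μ g θ + 2 * ∫ x, |f x - g x| ∂μ := by
        rw [integral_add hg' (hrot.fun_add hfst), integral_add hrot hfst, hrot_eq, hfst_eq,
          rotationVariation, two_mul]

theorem integrable_of_lipschitzWith {K : NNReal} (hg : LipschitzWith K g) : Integrable g μ := by
  refine ((integrable_const |g 0|).add (IsGaussian.integrable_id.norm.const_mul K)).mono'
    hg.continuous.aestronglyMeasurable (ae_of_all _ fun x => ?_)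
  have h := (abs_sub_abs_le_abs_sub _ _).trans (hg.dist_le_mul x 0)
  rw [dist_zero_right] at h
  exact sub_le_iff_le_add'.1 h

theorem rotationVariation_le_integral_abs_fderiv (hμ : μ[id] = 0) {K : NNReal}
    (hg : LipschitzWith K g) (hdiff : ∀ᵐ x ∂μ, DifferentiableAt ℝ g x) (θ : ℝ) :
    rotationVariation μ g θ ≤ ∫ w : E × E, |θ * fderiv ℝ g w.1 w.2| ∂(μ.prod μ) := by
  have hgi : Integrable g μ := integrable_of_lipschitzWith hg
  have hlim : Tendsto (fun n : ℕ => n * rotationVariation μ g (θ / n)) atTop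
      (𝓝 (∫ w : E × E, |θ * fderiv ℝ g w.1 w.2| ∂(μ.prod μ))) := by
    have hnorm : Integrable (fun x : E => ‖x‖) μ := IsGaussian.integrable_id.norm
    simp_rw [rotationVariation, ← integral_const_mul]
    refine tendsto_integral_of_dominated_convergence
      (fun w : E × E => |θ| * (K * (‖w.1‖ + ‖w.2‖)))
      (fun n => ((integrable_rotationVariation hμ hgi _).const_mul _).1)
      ((((hnorm.comp_fst μ).add (hnorm.comp_snd μ)).const_mul _).const_mul _)
      (fun n => ae_of_all _ fun w => ?_) ?_
    · rw [Real.norm_of_nonneg (by positivity)]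
      calc n * |g (rotation (θ / n) w).1 - g w.1|
          ≤ n * (K * (|θ / n| * (‖w.1‖ + ‖w.2‖))) := by
            gcongr
            refine (hg.dist_le_mul _ _).trans ?_
            gcongr
            exact (dist_eq_norm _ _).trans_le (norm_rotation_fst_sub_le _ _)
        _ = |θ| * (n / n) * (K * (‖w.1‖ + ‖w.2‖)) := by rw [abs_div, Nat.abs_cast]; ring
        _ ≤ |θ| * (K * (‖w.1‖ + ‖w.2‖)) := by
            gcongr
            exact mul_le_of_le_one_right (abs_nonneg θ) (div_self_le_one _)
    · filter_upwards [Measure.quasiMeasurePreserving_fst.ae hdiff] with w hw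
      exact tendsto_nat_mul_abs_rotation_fst_sub hw θ
  refine ge_of_tendsto hlim ?_
  filter_upwards [eventually_ne_atTop 0] with n hn
  simpa only [mul_div_cancel₀ θ (Nat.cast_ne_zero.2 hn)] using
    rotationVariation_nat_mul_le hμ hgi n (θ / n)

end RotationVariation

section AbsolutelyContinuous

theorem absolutelyContinuous_pi {n : ℕ} {X : Fin n → Type*} [∀ i, MeasurableSpace (X i)]
    {μ ν : ∀ i, Measure (X i)} [∀ i, SigmaFinite (μ i)] [∀ i, SigmaFinite (ν i)]
    (h : ∀ i, μ i ≪ ν i) : Measure.pi μ ≪ Measure.pi ν := by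
  induction n with
  | zero => rw [Measure.pi_of_empty μ isEmptyElim, Measure.pi_of_empty ν isEmptyElim]
  | succ n ih =>
    rw [← (measurePreserving_piFinSuccAbove μ 0).symm.map_eq,
      ← (measurePreserving_piFinSuccAbove ν 0).symm.map_eq]
    exact ((h 0).prod (ih fun i => h _)).map (MeasurableEquiv.measurable _)

theorem stdGaussian_absolutelyContinuous {E : Type*} [NormedAddCommGroup E]
    [InnerProductSpace ℝ E] [FiniteDimensional ℝ E] [MeasurableSpace E] [BorelSpace E] :
    stdGaussian E ≪ volume := by
  have b := stdOrthonormalBasis ℝ E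
  have hpi : stdGaussian (EuclideanSpace ℝ (Fin (Module.finrank ℝ E))) ≪ volume := by
    rw [← map_pi_eq_stdGaussian, ← (PiLp.volume_preserving_toLp _).map_eq]
    exact (absolutelyContinuous_pi fun _ =>
      gaussianReal_absolutelyContinuous 0 one_ne_zero).map (by fun_prop)
  rw [← stdGaussian_map b.repr.symm, ← b.measurePreserving_repr_symm.map_eq]
  exact hpi.map b.measurePreserving_repr_symm.measurable

end AbsolutelyContinuous

section ThickenedIndicator

variable {E : Type*} {δ : ℝ} (hδ : 0 < δ) (H : Set E)

theorem abs_indicator_sub_thickenedIndicator_le [PseudoEMetricSpace E] (x : E) :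
    |H.indicator (fun _ => (1 : ℝ)) x - (thickenedIndicator hδ H x : ℝ)|
      ≤ (Metric.thickening δ H \ H).indicator (fun _ => (1 : ℝ)) x := by
  by_cases hx : x ∈ H
  · simp [hx, thickenedIndicator_one hδ H hx]
  by_cases hx' : x ∈ Metric.thickening δ H
  · simpa [hx, hx'] using thickenedIndicator_le_one hδ H x
  · simp [hx, hx', thickenedIndicator_zero hδ H hx']

theorem norm_fderiv_thickenedIndicator_le [NormedAddCommGroup E] [NormedSpace ℝ E] (x : E) :
    ‖fderiv ℝ (fun y => (thickenedIndicator hδ H y : ℝ)) x‖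
      ≤ (Metric.thickening δ H \ H).indicator (fun _ => δ⁻¹) x := by
  by_cases hx : x ∈ H
  · have hmax : IsLocalMax (fun y => (thickenedIndicator hδ H y : ℝ)) x :=
      Eventually.of_forall fun y => by
        simp only [thickenedIndicator_one hδ H hx]
        exact NNReal.coe_le_coe.2 (thickenedIndicator_le_one hδ H y)
    rw [hmax.fderiv_eq_zero]
    simp [hx]
  by_cases hx' : x ∈ Metric.thickening δ H
  · have hlip : LipschitzWith δ.toNNReal⁻¹ (fun y => (thickenedIndicator hδ H y : ℝ)) :=
      lipschitzWith_thickenedIndicator hδ H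
    simpa [hx, hx', hδ.le] using norm_fderiv_le_of_lipschitz ℝ hlip (x₀ := x)
  · have hmin : IsLocalMin (fun y => (thickenedIndicator hδ H y : ℝ)) x :=
      Eventually.of_forall fun y => by simp [thickenedIndicator_zero hδ H hx']
    rw [hmin.fderiv_eq_zero]
    simp [hx']

end ThickenedIndicator

section SurfaceArea

variable {E : Type*} [NormedAddCommGroup E] [InnerProductSpace ℝ E] [FiniteDimensional ℝ E]
  [MeasurableSpace E] [BorelSpace E]

local notation "γ" => stdGaussian E

theorem integral_abs_strongDual_stdGaussian_le (ℓ : StrongDual ℝ E) : ∫ z, |ℓ z| ∂γ ≤ ‖ℓ‖ := by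
  refine integral_abs_le_of_integral_sq_le (ℓ.comp_memLp' IsGaussian.memLp_two_id)
    (norm_nonneg _) ?_
  rw [← variance_dual_stdGaussian, variance_of_integral_eq_zero (by fun_prop)
    (integral_strongDual_stdGaussian ℓ)]
  rfl

theorem integrable_fderiv_apply_of_lipschitzWith {K : NNReal} {g : E → ℝ}
    (hg : LipschitzWith K g) :
    Integrable (fun w : E × E => fderiv ℝ g w.1 w.2) ((γ).prod γ) := by
  have happly : Continuous fun q : StrongDual ℝ E × E => q.1 q.2 := by fun_prop
  refine ((IsGaussian.integrable_id (μ := γ)).norm.comp_snd γ).const_mul (K : ℝ) |>.mono'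
    (happly.measurable.comp (((measurable_fderiv ℝ g).comp measurable_fst).prodMk
      measurable_snd)).aestronglyMeasurable (ae_of_all _ fun w => ?_)
  exact ContinuousLinearMap.le_of_opNorm_le _ (norm_fderiv_le_of_lipschitz ℝ hg) _

theorem rotationVariation_le_integral_norm_fderiv {K : NNReal} {g : E → ℝ}
    (hg : LipschitzWith K g) (θ : ℝ) :
    rotationVariation γ g θ ≤ |θ| * ∫ x, ‖fderiv ℝ g x‖ ∂γ := by
  have hint := ((integrable_fderiv_apply_of_lipschitzWith hg).const_mul θ).abs
  have hnorm : Integrable (fun x => ‖fderiv ℝ g x‖) γ :=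
    .of_bound (measurable_fderiv ℝ g).norm.aestronglyMeasurable K
      (ae_of_all _ fun x => by rw [norm_norm]; exact norm_fderiv_le_of_lipschitz ℝ hg)
  calc rotationVariation γ g θ
      ≤ ∫ w : E × E, |θ * fderiv ℝ g w.1 w.2| ∂((γ).prod γ) :=
        rotationVariation_le_integral_abs_fderiv (by simp) hg
          (stdGaussian_absolutelyContinuous.ae_le hg.ae_differentiableAt) θ
    _ = ∫ x, ∫ z, |θ * fderiv ℝ g x z| ∂γ ∂γ := integral_prod _ hint
    _ ≤ ∫ x, |θ| * ‖fderiv ℝ g x‖ ∂γ := by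
        refine integral_mono hint.integral_prod_left (hnorm.const_mul _) fun x => ?_
        simp only [abs_mul, integral_const_mul]
        gcongr
        exact integral_abs_strongDual_stdGaussian_le _
    _ = |θ| * ∫ x, ‖fderiv ℝ g x‖ ∂γ := integral_const_mul _ _

theorem rotationVariation_indicator_le_thickening {H : Set E} (hH : MeasurableSet H) {δ : ℝ}
    (hδ : 0 < δ) (θ : ℝ) :
    rotationVariation γ (H.indicator fun _ => (1 : ℝ)) θ
      ≤ (|θ| + 2 * δ) * ((γ).real (Metric.thickening δ H \ H) / δ) := by
  set D := Metric.thickening δ H \ H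
  set f : E → ℝ := H.indicator fun _ => 1
  set g : E → ℝ := fun y => thickenedIndicator hδ H y
  have hD : MeasurableSet D := Metric.isOpen_thickening.measurableSet.diff hH
  have hf : Integrable f γ := (integrable_const _).indicator hH
  have hg : LipschitzWith δ.toNNReal⁻¹ g := lipschitzWith_thickenedIndicator hδ H
  have hgrad : ∫ x, ‖fderiv ℝ g x‖ ∂γ ≤ (γ).real D / δ := by
    rw [div_eq_mul_inv, ← smul_eq_mul, ← integral_indicator_const _ hD]
    exact integral_mono_of_nonneg (ae_of_all _ fun x => norm_nonneg _)
      ((integrable_const _).indicator hD)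
      (ae_of_all _ (norm_fderiv_thickenedIndicator_le hδ H))
  have hdist : ∫ x, |f x - g x| ∂γ ≤ (γ).real D := by
    rw [← mul_one ((γ).real D), ← smul_eq_mul, ← integral_indicator_const _ hD]
    exact integral_mono_of_nonneg (ae_of_all _ fun x => abs_nonneg _)
      ((integrable_const _).indicator hD)
      (ae_of_all _ (abs_indicator_sub_thickenedIndicator_le hδ H))
  calc rotationVariation γ f θ
      ≤ rotationVariation γ g θ + 2 * ∫ x, |f x - g x| ∂γ :=
        rotationVariation_le_add_integral_abs_sub (by simp) hf (integrable_of_lipschitzWith hg) θ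
    _ ≤ |θ| * ((γ).real D / δ) + 2 * (γ).real D := by
        gcongr
        exact (rotationVariation_le_integral_norm_fderiv hg θ).trans (by gcongr)
    _ = (|θ| + 2 * δ) * ((γ).real D / δ) := by field_simp

end SurfaceArea

theorem rotationVariation_indicator_le {d : ℕ} {H : Set (EuclideanSpace ℝ (Fin d))}
    (hH : MeasurableSet H) (hΓ : gaussianSurfaceArea H ≠ ⊤) (θ : ℝ) :
    rotationVariation (stdGaussian _) (H.indicator fun _ => (1 : ℝ)) θ
      ≤ |θ| * (gaussianSurfaceArea H).toReal := by
  set Γ := (gaussianSurfaceArea H).toReal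
  have hle (η : ℝ) (hη : 0 < η) : rotationVariation (stdGaussian _) (H.indicator fun _ => (1 : ℝ)) θ
      ≤ (|θ| + 2 * η) * (Γ + η) := by
    have hlt : gaussianSurfaceArea H < ENNReal.ofReal (Γ + η) := by
      rw [ENNReal.lt_ofReal_iff_toReal_lt hΓ]
      exact lt_add_of_pos_right Γ hη
    obtain ⟨δ, hδ, hδ0, hδη⟩ := ((frequently_lt_of_liminf_lt (by isBoundedDefault)
      hlt).and_eventually (Ioo_mem_nhdsGT hη)).exists
    have hquot : (stdGaussian _).real (Metric.thickening δ H \ H) / δ ≤ Γ + η := by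
      have h := ENNReal.toReal_mono ENNReal.ofReal_ne_top hδ.le
      rwa [ENNReal.toReal_div, ENNReal.toReal_ofReal hδ0.le,
        ENNReal.toReal_ofReal (by positivity)] at h
    refine (rotationVariation_indicator_le_thickening hH hδ0 θ).trans ?_
    gcongr
  have hlim : Tendsto (fun η : ℝ => (|θ| + 2 * η) * (Γ + η)) (𝓝[>] 0) (𝓝 (|θ| * Γ)) :=
    tendsto_nhdsWithin_of_tendsto_nhds (Continuous.tendsto' (by fun_prop) _ _ (by simp))
  exact ge_of_tendsto hlim (eventually_nhdsWithin_of_forall hle)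

section SquaredApproximation

-- The outer terms on the right integrate to at most `0` when `∫ u ^ 2 ≤ 1` and `∫ u = ∫ s`.
theorem abs_sq_one_add_sub_le {s : ℝ} (hs : |s| = 1) (u : ℝ) :
    |(1 + u) ^ 2 / 4 - (1 + s) / 2| ≤ (u ^ 2 - 1) / 4 + |u - s| + (s - u) / 2 := by
  rcases (abs_eq zero_le_one).1 hs with rfl | rfl
  · rcases abs_cases (u - 1) with ⟨h, hu⟩ | ⟨h, hu⟩ <;> rw [h, abs_le] <;> constructor <;>
      nlinarith [sq_nonneg (u - 1)]
  · have := le_abs_self (u - -1)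
    rw [abs_of_nonneg (by nlinarith [sq_nonneg (1 + u)])]
    nlinarith

variable {Ω : Type*} [MeasurableSpace Ω] {μ : Measure Ω} [IsProbabilityMeasure μ] {s u : Ω → ℝ}

theorem integral_abs_sq_one_add_sub_le (hsm : AEStronglyMeasurable s μ) (hs : ∀ x, |s x| = 1)
    (hu : MemLp u 2 μ) (hmean : ∫ x, u x ∂μ = ∫ x, s x ∂μ) (hsq : ∫ x, u x ^ 2 ∂μ ≤ 1) :
    ∫ x, |(1 + u x) ^ 2 / 4 - (1 + s x) / 2| ∂μ ≤ ∫ x, |u x - s x| ∂μ := by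
  have hsi : Integrable s μ := .of_bound hsm 1 (ae_of_all _ fun x => (hs x).le)
  have hui : Integrable u μ := hu.integrable one_le_two
  have hsquare : Integrable (fun x => (u x ^ 2 - 1) / 4) μ :=
    (hu.integrable_sq.sub (integrable_const 1)).div_const 4
  have habs : Integrable (fun x => |u x - s x|) μ := (hui.sub hsi).abs
  have hdiff : Integrable (fun x => (s x - u x) / 2) μ := (hsi.sub hui).div_const 2
  calc ∫ x, |(1 + u x) ^ 2 / 4 - (1 + s x) / 2| ∂μ
      ≤ ∫ x, ((u x ^ 2 - 1) / 4 + |u x - s x| + (s x - u x) / 2) ∂μ :=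
        integral_mono_of_nonneg (ae_of_all _ fun x => abs_nonneg _)
          ((hsquare.add habs).add hdiff) (ae_of_all _ fun x => abs_sq_one_add_sub_le (hs x) (u x))
    _ = (∫ x, u x ^ 2 ∂μ - 1) / 4 + ∫ x, |u x - s x| ∂μ := by
        rw [integral_add (hsquare.fun_add habs) hdiff, integral_add hsquare habs, integral_div,
          integral_div, integral_sub hsi hui, integral_sub hu.integrable_sq (integrable_const 1),
          hmean, sub_self, zero_div, add_zero, integral_const, probReal_univ, one_smul]
    _ ≤ ∫ x, |u x - s x| ∂μ := by linarith

end SquaredApproximation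

section SignFunction

variable {d : ℕ} {H : Set (EuclideanSpace ℝ (Fin d))}

local notation "𝕍" => EuclideanSpace ℝ (Fin d)
local notation "γ" => stdGaussian (EuclideanSpace ℝ (Fin d))

theorem abs_signFn (H : Set 𝕍) (x : 𝕍) : |signFn H x| = 1 := by
  by_cases hx : x ∈ H <;> norm_num [signFn, hx]

theorem memLp_signFn (hH : MeasurableSet H) (p : ENNReal) : MemLp (signFn H) p γ :=
  .of_bound (((measurable_const.indicator hH).const_mul 2).sub_const 1).aestronglyMeasurable 1
    (ae_of_all _ fun x => (abs_signFn H x).le)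

theorem integral_sq_signFn (H : Set 𝕍) : ∫ x, signFn H x ^ 2 ∂γ = 1 := by
  simp [← sq_abs (signFn H _), abs_signFn]

theorem rotationVariation_signFn (H : Set 𝕍) (θ : ℝ) :
    rotationVariation γ (signFn H) θ
      = 2 * rotationVariation γ (H.indicator fun _ => (1 : ℝ)) θ := by
  simp only [rotationVariation, signFn, sub_sub_sub_cancel_right, ← mul_sub, abs_mul, abs_two,
    integral_const_mul]

theorem integral_abs_ornsteinUhlenbeck_sub_le {ρ : ℝ} (h1 : -1 ≤ ρ) (h2 : ρ ≤ 1) {f : 𝕍 → ℝ}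
    (hf : MemLp f 2 γ) :
    ∫ x, |ornsteinUhlenbeck ρ f x - f x| ∂γ ≤ rotationVariation γ f (Real.arccos ρ) := by
  have hfi : Integrable f γ := hf.integrable one_le_two
  have hrot := integrable_comp_rotation_fst (by simp) (Real.arccos ρ) hfi
  have hvar := integrable_rotationVariation (by simp) hfi (Real.arccos ρ)
  rw [rotationVariation, integral_prod _ hvar]
  refine integral_mono_ae (((memLp_ornsteinUhlenbeck h1 h2 hf).integrable one_le_two).sub hfi).abs
    hvar.integral_prod_left ?_
  filter_upwards [hrot.prod_right_ae] with x hx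
  have hsub : ornsteinUhlenbeck ρ f x - f x
      = ∫ z, (f (ContinuousLinearMap.rotation (Real.arccos ρ) (x, z)).1 - f x) ∂γ := by
    rw [integral_sub hx (integrable_const _), integral_const, probReal_univ, one_smul,
      ornsteinUhlenbeck_eq_integral_rotation h1 h2]
  rw [hsub]
  exact abs_integral_le_integral_abs

theorem integral_abs_hermiteTrunc_sub_signFn_le (hH : MeasurableSet H)
    (hΓ : gaussianSurfaceArea H ≠ ⊤) {ρ : ℝ} (h0 : 0 ≤ ρ) (h1 : ρ ≤ 1) (t : ℕ) :
    ∫ x, |evalAt (hermiteTrunc t (ornsteinUhlenbeck ρ (signFn H))) x - signFn H x| ∂γ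
      ≤ ρ ^ (t + 1) + 2 * (Real.arccos ρ * (gaussianSurfaceArea H).toReal) := by
  have hρ : -1 ≤ ρ := by linarith
  have hs := memLp_signFn hH 2
  have hT := memLp_ornsteinUhlenbeck hρ h1 hs
  set T := ornsteinUhlenbeck ρ (signFn H)
  have hp := memLp_evalAt (hermiteTrunc t T) (r := 2) ENNReal.ofNat_ne_top
  set p := evalAt (hermiteTrunc t T)
  have hpT : Integrable (fun x => |p x - T x|) γ := ((hp.sub hT).integrable one_le_two).abs
  have hTs : Integrable (fun x => |T x - signFn H x|) γ := ((hT.sub hs).integrable one_le_two).abs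
  have htrunc : ∫ x, |p x - T x| ∂γ ≤ ρ ^ (t + 1) := by
    refine integral_abs_le_of_integral_sq_le (hp.sub hT) (by positivity) ?_
    refine (integral_sq_hermiteTrunc_sub_ornsteinUhlenbeck_le h0 h1 hs t).trans_eq ?_
    rw [integral_sq_signFn, mul_one]
  have hsmooth : ∫ x, |T x - signFn H x| ∂γ
      ≤ 2 * (Real.arccos ρ * (gaussianSurfaceArea H).toReal) := by
    refine (integral_abs_ornsteinUhlenbeck_sub_le hρ h1 hs).trans ?_
    rw [rotationVariation_signFn]
    gcongr
    simpa only [abs_of_nonneg (Real.arccos_nonneg ρ)] using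
      rotationVariation_indicator_le hH hΓ (Real.arccos ρ)
  calc ∫ x, |p x - signFn H x| ∂γ
      ≤ ∫ x, (|p x - T x| + |T x - signFn H x|) ∂γ :=
        integral_mono ((hp.sub hs).integrable one_le_two).abs (hpT.add hTs)
          fun x => abs_sub_le _ _ _
    _ = ∫ x, |p x - T x| ∂γ + ∫ x, |T x - signFn H x| ∂γ := integral_add hpT hTs
    _ ≤ ρ ^ (t + 1) + 2 * (Real.arccos ρ * (gaussianSurfaceArea H).toReal) :=
        add_le_add htrunc hsmooth

theorem integral_abs_sq_hermiteTrunc_sub_indicator_le (hH : MeasurableSet H) {ρ : ℝ}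
    (h1 : -1 ≤ ρ) (h2 : ρ ≤ 1) (t : ℕ) :
    ∫ x, |evalAt (MvPolynomial.C (1 / 4)
        * (1 + hermiteTrunc t (ornsteinUhlenbeck ρ (signFn H))) ^ 2) x
        - H.indicator (fun _ => (1 : ℝ)) x| ∂γ
      ≤ ∫ x, |evalAt (hermiteTrunc t (ornsteinUhlenbeck ρ (signFn H))) x - signFn H x| ∂γ := by
  have hs := memLp_signFn hH 2
  convert integral_abs_sq_one_add_sub_le hs.1 (abs_signFn H)
    (memLp_evalAt _ ENNReal.ofNat_ne_top)
    (integral_hermiteTrunc_ornsteinUhlenbeck h1 h2 hs t)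
    ((integral_sq_hermiteTrunc_ornsteinUhlenbeck_le h1 h2 hs t).trans_eq
      (integral_sq_signFn H)) using 5 with x
  · simp only [evalAt_mul, evalAt_C, evalAt_pow, evalAt_add, evalAt_one]
    ring
  · rw [signFn]
    ring

end SignFunction

theorem totalDegree_C_mul_one_add_sq_le {σ R : Type*} [CommSemiring R] (c : R)
    (p : MvPolynomial σ R) :
    (MvPolynomial.C c * (1 + p) ^ 2).totalDegree ≤ 2 * p.totalDegree := by
  calc (MvPolynomial.C c * (1 + p) ^ 2).totalDegree
      ≤ ((1 + p) ^ 2).totalDegree := by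
        simpa using MvPolynomial.totalDegree_mul (MvPolynomial.C c) ((1 + p) ^ 2)
    _ ≤ 2 * (1 + p).totalDegree := MvPolynomial.totalDegree_pow _ _
    _ ≤ 2 * p.totalDegree := by
        simpa using MvPolynomial.totalDegree_add 1 p

section Parameters

variable {θ G ε : ℝ}

theorem cos_le_exp_neg_sq (hθ : |θ| ≤ Real.pi) : Real.cos θ ≤ Real.exp (-(θ ^ 2 / 5)) := by
  have hπ : (1 : ℝ) / 5 ≤ 2 / Real.pi ^ 2 := by
    rw [div_le_div_iff₀ (by norm_num) (by positivity)]
    nlinarith [Real.pi_lt_d2, Real.pi_pos]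
  calc Real.cos θ ≤ 1 - 2 / Real.pi ^ 2 * θ ^ 2 := Real.cos_le_one_sub_mul_cos_sq hθ
    _ ≤ 1 - 1 / 5 * θ ^ 2 := by gcongr
    _ ≤ Real.exp (-(θ ^ 2 / 5)) := by linarith [Real.one_sub_le_exp_neg (θ ^ 2 / 5)]

theorem cos_pow_le_of_log_le (h0 : 0 ≤ θ) (hπ : θ ≤ Real.pi / 2) (hε : 0 < ε) {n : ℕ}
    (hn : Real.log (1 / ε) ≤ n * (θ ^ 2 / 5)) : Real.cos θ ^ n ≤ ε := by
  have hθ : |θ| ≤ Real.pi := by rw [abs_of_nonneg h0]; linarith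
  calc Real.cos θ ^ n ≤ Real.exp (-(θ ^ 2 / 5)) ^ n :=
        pow_le_pow_left₀ (Real.cos_nonneg_of_mem_Icc ⟨by linarith, hπ⟩) (cos_le_exp_neg_sq hθ) n
    _ = Real.exp (-(n * (θ ^ 2 / 5))) := by rw [← Real.exp_nat_mul, mul_neg]
    _ ≤ Real.exp (-Real.log (1 / ε)) := by gcongr
    _ = ε := by rw [one_div, Real.log_inv, neg_neg, Real.exp_log hε]

theorem log_two_div_le (h0 : 0 < ε) (h1 : ε ≤ 1 / 2) :
    Real.log (2 / ε) ≤ 2 * Real.log (1 / ε) := by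
  have hlog : Real.log 2 ≤ Real.log (1 / ε) :=
    Real.log_le_log two_pos ((le_div_comm₀ two_pos h0).2 h1)
  rw [div_eq_mul_one_div, Real.log_mul two_ne_zero (by positivity)]
  linarith

-- With `θ = ε / (4 * G)` the noise costs `2 * θ * G = ε / 2`, and degree
-- `(5 / θ ^ 2) * log (2 / ε) = 80 * (G / ε) ^ 2 * log (2 / ε)` brings the tail below `ε / 2`.
-- When `G` is so small that this angle leaves `[0, π / 2]`, already `ρ = 0` and `t = 0` will do.
theorem exists_correlation_degree (hG : 0 ≤ G) (h0 : 0 < ε) (h1 : ε < 1 / 2) :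
    ∃ (ρ : ℝ) (t : ℕ), 0 ≤ ρ ∧ ρ ≤ 1 ∧ ρ ^ (t + 1) + 2 * (Real.arccos ρ * G) ≤ ε ∧
      2 * (t : ℝ) ≤ 320 * (G ^ 2 / ε ^ 2 * Real.log (1 / ε)) := by
  have hε : 1 ≤ 1 / ε := (le_div_comm₀ one_pos h0).2 (by linarith)
  have hlog : 0 ≤ Real.log (1 / ε) := Real.log_nonneg hε
  rcases le_or_gt (Real.pi * G) ε with hsmall | hlarge
  · refine ⟨0, 0, le_rfl, zero_le_one, ?_, by rw [Nat.cast_zero, mul_zero]; positivity⟩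
    rw [Real.arccos_zero]
    linarith
  have hGpos : 0 < G := hG.lt_of_ne' (by rintro rfl; linarith)
  set θ := ε / (4 * G)
  have hθ0 : 0 ≤ θ := by positivity
  have hθπ : θ ≤ Real.pi / 2 := (div_le_iff₀ (by positivity)).2 (by linarith)
  set A := 80 * (G ^ 2 / ε ^ 2) * Real.log (2 / ε) with hA
  refine ⟨Real.cos θ, ⌊A⌋₊, Real.cos_nonneg_of_mem_Icc ⟨by linarith, hθπ⟩, Real.cos_le_one θ,
    ?_, ?_⟩
  · have hnoise : 2 * (θ * G) = ε / 2 := by simp only [θ]; field_simp; norm_num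
    have htail : Real.cos θ ^ (⌊A⌋₊ + 1) ≤ ε / 2 := by
      refine cos_pow_le_of_log_le hθ0 hθπ (by positivity) ?_
      calc Real.log (1 / (ε / 2)) = A * (θ ^ 2 / 5) := by
            rw [one_div_div, hA]; simp only [θ]; field_simp; ring
        _ ≤ (⌊A⌋₊ + 1 : ℕ) * (θ ^ 2 / 5) := by
            gcongr
            exact_mod_cast (Nat.lt_floor_add_one A).le
    rw [Real.arccos_cos hθ0 (by linarith)]
    linarith
  · have hlog2 : 0 ≤ Real.log (2 / ε) := Real.log_nonneg (by rw [le_div_iff₀ h0]; linarith)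
    calc 2 * (⌊A⌋₊ : ℝ) ≤ 2 * A := by gcongr; exact Nat.floor_le (by positivity)
      _ ≤ 2 * (80 * (G ^ 2 / ε ^ 2) * (2 * Real.log (1 / ε))) := by
          rw [hA]
          gcongr
          exact log_two_div_le h0 h1.le
      _ = 320 * (G ^ 2 / ε ^ 2 * Real.log (1 / ε)) := by ring

end Parameters

end GSAApprox

theorem theorem1 :
    ∃ C : ℝ, 0 < C ∧
      ∀ (d : ℕ) (𝓗 : Set (Set (EuclideanSpace ℝ (Fin d)))),
        (∀ H ∈ 𝓗, MeasurableSet H) →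
        GSAApprox.classSurfaceArea 𝓗 < ⊤ →
        ∀ H ∈ 𝓗, ∀ ε : ℝ, 0 < ε → ε < 1 / 2 →
          ∃ q : MvPolynomial (Fin d) ℝ,
            (∀ x, 0 ≤ GSAApprox.evalAt q x) ∧
            Integrable (fun x => |GSAApprox.evalAt q x - H.indicator (fun _ => (1 : ℝ)) x|)
              (stdGaussian (EuclideanSpace ℝ (Fin d))) ∧
            ∫ x, |GSAApprox.evalAt q x - H.indicator (fun _ => (1 : ℝ)) x|
              ∂(stdGaussian (EuclideanSpace ℝ (Fin d))) ≤ ε ∧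
            (q.totalDegree : ℝ) ≤
              C * ((GSAApprox.classSurfaceArea 𝓗).toReal ^ 2 / ε ^ 2
                * Real.log (1 / ε)) ∧
            -- the construction, and the comparison with the unconstrained approximation `p`
            ∃ (ρ : ℝ) (t : ℕ) (p : MvPolynomial (Fin d) ℝ), 0 ≤ ρ ∧ ρ ≤ 1 ∧
              p = GSAApprox.hermiteTrunc t
                (GSAApprox.ornsteinUhlenbeck ρ (GSAApprox.signFn H)) ∧
              q = MvPolynomial.C (1 / 4) * (1 + p) ^ 2 ∧
              p.totalDegree ≤ t ∧
              q.totalDegree ≤ 2 * t ∧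
              2 * (t : ℝ) ≤
                C * ((GSAApprox.classSurfaceArea 𝓗).toReal ^ 2 / ε ^ 2
                  * Real.log (1 / ε)) ∧
              Integrable (fun x => |GSAApprox.evalAt p x - GSAApprox.signFn H x|)
                (stdGaussian (EuclideanSpace ℝ (Fin d))) ∧
              ∫ x, |GSAApprox.evalAt p x - GSAApprox.signFn H x|
                ∂(stdGaussian (EuclideanSpace ℝ (Fin d))) ≤ ε := by
  refine ⟨320, by norm_num, fun d 𝓗 hmeas hfin H hH ε hε hε' => ?_⟩
  have hle : GSAApprox.gaussianSurfaceArea H ≤ GSAApprox.classSurfaceArea 𝓗 :=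
    le_iSup₂ (f := fun K (_ : K ∈ 𝓗) => GSAApprox.gaussianSurfaceArea K) H hH
  obtain ⟨ρ, t, h0, h1, herr, hdeg⟩ := GSAApprox.exists_correlation_degree
    (G := (GSAApprox.classSurfaceArea 𝓗).toReal) ENNReal.toReal_nonneg hε hε'
  have hs := GSAApprox.memLp_signFn (hmeas H hH) 1
  have hind : MemLp (H.indicator fun _ => (1 : ℝ)) 1
      (stdGaussian (EuclideanSpace ℝ (Fin d))) := (memLp_const 1).indicator (hmeas H hH)
  have hpε := (GSAApprox.integral_abs_hermiteTrunc_sub_signFn_le (hmeas H hH)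
    (hle.trans_lt hfin).ne h0 h1 t).trans <| (add_le_add_right (mul_le_mul_of_nonneg_left
      (mul_le_mul_of_nonneg_left (ENNReal.toReal_mono hfin.ne hle) (Real.arccos_nonneg ρ))
      zero_le_two) _).trans herr
  have hqε := (GSAApprox.integral_abs_sq_hermiteTrunc_sub_indicator_le (hmeas H hH)
    (by linarith) h1 t).trans hpε
  have hpt := GSAApprox.totalDegree_hermiteTrunc_le t
    (GSAApprox.ornsteinUhlenbeck ρ (GSAApprox.signFn H))
  have hqt := (GSAApprox.totalDegree_C_mul_one_add_sq_le (1 / 4 : ℝ) _).trans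
    (Nat.mul_le_mul_left 2 hpt)
  refine ⟨_, fun x => ?_, ?_, hqε, ?_, ρ, t, _, h0, h1, rfl, rfl, hpt, hqt, hdeg, ?_, hpε⟩
  · rw [GSAApprox.evalAt_mul, GSAApprox.evalAt_C, GSAApprox.evalAt_pow]
    positivity
  · exact (((GSAApprox.memLp_evalAt _ ENNReal.one_ne_top).sub hind).integrable le_rfl).abs
  · exact (Nat.cast_le.2 hqt).trans (by exact_mod_cast hdeg)
  · exact (((GSAApprox.memLp_evalAt _ ENNReal.one_ne_top).sub hs).integrable le_rfl).abs
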